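/- **Proposition (The Bach tensor).** Let $U\subseteq(0,\infty)$ be open, let $B\in C^4(U)$ with $B>0$, and consider the static spherical metric $$ds^2=-B(r)\,dt^2+\frac{dr^2}{B(r)}+r^2\left(d\theta^2+\sin^2\theta\,d\phi^2\right)$$ for $r\in U$, $0<\theta<\pi$, with Levi-Civita connection $\nabla$. The Riemann tensor is defined by $(\nabla_j\nabla_k-\nabla_k\nabla_j)v_l=R_{jklm}v^m$, and $R_{km}=g^{jl}R_{jklm}$, $R=g^{jk}R_{jk}$. The Weyl tensor is $$C_{jklm}=R_{jklm}+\tfrac12\left(g_{jm}R_{kl}-g_{km}R_{jl}+g_{kl}R_{jm}-g_{jl}R_{km}\right)-\tfrac R6\left(g_{jm}g_{kl}-g_{km}g_{jl}\right),$$ the Cotton tensor is $C_{jkl}=\nabla_jR_{kl}-\nabla_kR_{jl}-\tfrac16(g_{kl}\nabla_jR-g_{jl}\nabla_kR)$, and the Bach tensor is $$\mathscr B_{kl}=2\nabla^j\nabla^mC_{jklm}+R^{jm}C_{jklm}.$$ Let $u_k=(-\sqrt B,0,0,0)$ in the coordinates $(t,r,\theta,\phi)$, $\dot u_k=u^j\nabla_ju_k$,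 $\eta=\dot u^p\dot u_p$, and $$A(r)=\frac{1-B}{r^2}+\frac{B''}{2},\qquad E(r)=\frac12\left[\frac{1-B}{r^2}+\frac{B'}{r}-\frac{B''}{2}\right].$$ Then: 1. $\mathscr B_{kl}=-\nabla^jC_{jkl}+R^{jm}C_{jklm}$, and $\mathscr B_{kl}$ is symmetric and traceless. If $B\in C^5(U)$, it is divergence-free: $\nabla^k\mathscr B_{kl}=0$. 2. Let the functions $B_1,B_2$ of $r\in U$ be determined by $$B_1+B_2=-\frac{2B}{r}\left(A'+\frac Ar\right)-\frac{2B}{3}\left(A'+\frac Ar\right)',$$ $$B_1-B_2=-\frac83AE-\frac43\left(A'+\frac Ar\right)\left(B'+\frac Br\right)-\frac{4B}{3}\left(A'+\frac Ar\right)'.$$ At every point with $B'(r)\neq0$ one has $\eta>0$ and $$\mathscr B_{kl}=B_1\,u_ku_l+\frac14(B_1-B_2)\,g_{kl}+B_2\,\frac{\dot u_k\dot u_l}{\eta}.$$ -/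

import Mathlib

namespace StaticSpherical

/-- Coordinate points of a four-dimensional chart. The coordinates `0, 1, 2, 3` are
`t, r, θ, φ`. -/
abbrev Pt : Type := Fin 4 → ℝ

/-- The components of a metric, as a matrix-valued function on the chart. -/
abbrev Metric4 : Type := Pt → Matrix (Fin 4) (Fin 4) ℝ

noncomputable section

/-- The partial derivative `∂_i f` at `x`. -/
def pd (i : Fin 4) (f : Pt → ℝ) (x : Pt) : ℝ :=
  deriv (fun s : ℝ => f (Function.update x i s)) (x i)

/-- The inverse metric `g^{ij}`. -/
def ginv (g : Metric4) (x : Pt) (i j : Fin 4) : ℝ := (g x)⁻¹ i j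

/-- The Christoffel symbols `Γ^i_{jk}` of the Levi-Civita connection of `g`. -/
def christoffel (g : Metric4) (x : Pt) (i j k : Fin 4) : ℝ :=
  (1 / 2) * ∑ m, ginv g x i m *
    (pd j (fun y => g y m k) x + pd k (fun y => g y m j) x - pd m (fun y => g y j k) x)

/-- `∇_i T_j` -/
def cov1 (g : Metric4) (T : Pt → Fin 4 → ℝ) (x : Pt) (i j : Fin 4) : ℝ :=
  pd i (fun y => T y j) x - ∑ p, christoffel g x p i j * T x p

/-- `∇_i T_{jk}` -/
def cov2 (g : Metric4) (T : Pt → Fin 4 → Fin 4 → ℝ) (x : Pt) (i j k : Fin 4) : ℝ :=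
  pd i (fun y => T y j k) x
    - ∑ p, christoffel g x p i j * T x p k
    - ∑ p, christoffel g x p i k * T x j p

/-- `∇_i T_{jkl}` -/
def cov3 (g : Metric4) (T : Pt → Fin 4 → Fin 4 → Fin 4 → ℝ) (x : Pt)
    (i j k l : Fin 4) : ℝ :=
  pd i (fun y => T y j k l) x
    - ∑ p, christoffel g x p i j * T x p k l
    - ∑ p, christoffel g x p i k * T x j p l
    - ∑ p, christoffel g x p i l * T x j k p

/-- `∇_i T_{jklm}` -/
def cov4 (g : Metric4) (T : Pt → Fin 4 → Fin 4 → Fin 4 → Fin 4 → ℝ) (x : Pt)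
    (i j k l m : Fin 4) : ℝ :=
  pd i (fun y => T y j k l m) x
    - ∑ p, christoffel g x p i j * T x p k l m
    - ∑ p, christoffel g x p i k * T x j p l m
    - ∑ p, christoffel g x p i l * T x j k p m
    - ∑ p, christoffel g x p i m * T x j k l p

/-- The Riemann tensor `R_{jklm}`, with the sign convention
`(∇_j ∇_k - ∇_k ∇_j) v_l = R_{jklm} v^m`. -/
def riemann (g : Metric4) (x : Pt) (j k l m : Fin 4) : ℝ :=
  ∑ p, g x l p *
    (pd j (fun y => christoffel g y p k m) x - pd k (fun y => christoffel g y p j m) x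
      + ∑ q, (christoffel g x p j q * christoffel g x q k m
          - christoffel g x p k q * christoffel g x q j m))

/-- The Ricci tensor `R_{km} = g^{jl} R_{jklm}`. -/
def ricci (g : Metric4) (x : Pt) (k m : Fin 4) : ℝ :=
  ∑ j, ∑ l, ginv g x j l * riemann g x j k l m

/-- The curvature scalar `R = g^{jk} R_{jk}`. -/
def scalarCurv (g : Metric4) (x : Pt) : ℝ :=
  ∑ j, ∑ k, ginv g x j k * ricci g x j k

/-- The Weyl tensor `C_{jklm}` in dimension four. -/
def weyl (g : Metric4) (x : Pt) (j k l m : Fin 4) : ℝ :=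
  riemann g x j k l m
    + (1 / 2) * (g x j m * ricci g x k l - g x k m * ricci g x j l
        + g x k l * ricci g x j m - g x j l * ricci g x k m)
    - scalarCurv g x / 6 * (g x j m * g x k l - g x k m * g x j l)

/-- The Cotton tensor
`C_{jkl} = ∇_j R_{kl} - ∇_k R_{jl} - (g_{kl} ∇_j R - g_{jl} ∇_k R) / 6`. -/
def cotton (g : Metric4) (x : Pt) (j k l : Fin 4) : ℝ :=
  cov2 g (ricci g) x j k l - cov2 g (ricci g) x k j l
    - (1 / 6) * (g x k l * pd j (scalarCurv g) x - g x j l * pd k (scalarCurv g) x)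

/-- The divergence `∇^m C_{jklm}` of the Weyl tensor. -/
def divWeyl (g : Metric4) (x : Pt) (j k l : Fin 4) : ℝ :=
  ∑ m, ∑ n, ginv g x m n * cov4 g (weyl g) x n j k l m

/-- The divergence `∇^j T_{jkl}` on the first index of a tensor of rank three. -/
def div3 (g : Metric4) (T : Pt → Fin 4 → Fin 4 → Fin 4 → ℝ) (x : Pt) (k l : Fin 4) : ℝ :=
  ∑ j, ∑ i, ginv g x j i * cov3 g T x i j k l

/-- The divergence `∇^k T_{kl}` on the first index of a tensor of rank two. -/
def div2 (g : Metric4) (T : Pt → Fin 4 → Fin 4 → ℝ) (x : Pt) (l : Fin 4) : ℝ :=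
  ∑ k, ∑ i, ginv g x k i * cov2 g T x i k l

/-- The contraction `R^{jm} C_{jklm}`. -/
def ricciWeyl (g : Metric4) (x : Pt) (k l : Fin 4) : ℝ :=
  ∑ j, ∑ m, (∑ a, ∑ b, ginv g x j a * ginv g x m b * ricci g x a b) * weyl g x j k l m

/-- The Bach tensor `ℬ_{kl} = 2 ∇^j ∇^m C_{jklm} + R^{jm} C_{jklm}`. -/
def bach (g : Metric4) (x : Pt) (k l : Fin 4) : ℝ :=
  2 * div3 g (divWeyl g) x k l + ricciWeyl g x k l

/-- The metric `ds² = -B(r) dt² + dr² / B(r) + r² (dθ² + sin² θ dφ²)`. -/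
def metric (B : ℝ → ℝ) : Metric4 := fun x =>
  Matrix.diagonal
    ![-B (x 1), 1 / B (x 1), (x 1) ^ 2, (x 1) ^ 2 * Real.sin (x 2) ^ 2]

/-- The covariant components `u_k = (-√B, 0, 0, 0)` of the static velocity. -/
def velocity (B : ℝ → ℝ) (x : Pt) : Fin 4 → ℝ := ![-Real.sqrt (B (x 1)), 0, 0, 0]

/-- The acceleration `u̇_k = u^j ∇_j u_k`. -/
def acceleration (B : ℝ → ℝ) (x : Pt) (k : Fin 4) : ℝ :=
  ∑ j, (∑ i, ginv (metric B) x j i * velocity B x i) * cov1 (metric B) (velocity B) x j k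

/-- The squared norm `η = u̇^p u̇_p` of the acceleration. -/
def eta (B : ℝ → ℝ) (x : Pt) : ℝ :=
  ∑ p, ∑ q, ginv (metric B) x p q * acceleration B x p * acceleration B x q

/-- `A(r) = (1 - B) / r² + B'' / 2` -/
def coeffA (B : ℝ → ℝ) (r : ℝ) : ℝ :=
  (1 - B r) / r ^ 2 + deriv (deriv B) r / 2

/-- `E(r) = ((1 - B) / r² + B' / r - B'' / 2) / 2` -/
def coeffE (B : ℝ → ℝ) (r : ℝ) : ℝ :=
  (1 / 2) * ((1 - B r) / r ^ 2 + deriv B r / r - deriv (deriv B) r / 2)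

/-- `A' + A / r` -/
def coeffQ (B : ℝ → ℝ) (r : ℝ) : ℝ :=
  deriv (coeffA B) r + coeffA B r / r

end

end StaticSpherical

/-! In these coordinates every tensor component is a constant times a function of `r` times a
function of `θ`. Once `B` and its derivatives are replaced by symbols `b 0, b 1, ...`, each
curvature formula is a rational identity, and differentiating it only shifts the jet index
(`IsJet`). Derivatives are local, so a closed form valid on the open chart may be differentiated
there (`pd_congr`, `pd_of_eq_mul`).

Spherical symmetry makes the tensors nearly diagonal: Riemann acts by a scalar on each coordinate
plane, Ricci is diagonal, and the Weyl and Cotton tensors each reduce to a single radial function,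
`weylR` (which is E/3) and `cotP` (which is -2/3 of A' + A/r). The identity ∇^m C_{jklm} =
-C_{jkl}/2 (`RadialData.divWeyl_eq`) gives the Cotton form of the Bach tensor, and then
`RadialData.bach_eq` shows that it is diagonal, with eigenvalues λ₀, λ₁, λ₂, λ₂ relative to the
metric.

Symmetry is then immediate, the trace is λ₀ + λ₁ + 2λ₂ = 0, and the divergence reduces to one radial
equation. Since u_k u_l is -g on the tt entry and u̇_k u̇_l/η is g on the rr entry, comparing
eigenvalues gives B₁ = λ₂ - λ₀, B₂ = λ₁ - λ₂, and by the trace (B₁ - B₂)/4 = λ₂. -/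

namespace StaticSpherical

/-! ### Jets of the radial function and partial derivatives on the chart -/

/-- The part of the chart lying over `U` and away from the axis. -/
def chart (U : Set ℝ) : Set Pt := {x | x 1 ∈ U ∧ x 2 ∈ Set.Ioo 0 Real.pi}

/-- `b (n + 1)` is the derivative of `b n` on `U` for `n < N`. -/
def IsJet (b : ℕ → ℝ → ℝ) (N : ℕ) (U : Set ℝ) : Prop :=
  ∀ n < N, ∀ r ∈ U, HasDerivAt (b n) (b (n + 1) r) r

/-- Since `U` is open, the iterated derivatives on the whole line are the right ones at points of
`U`, whatever `B` does elsewhere. -/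
theorem isJet_iteratedDeriv {U : Set ℝ} (hU : IsOpen U) {B : ℝ → ℝ} {N : ℕ}
    (hB : ContDiffOn ℝ N B U) : IsJet (fun n => iteratedDeriv n B) N U := by
  intro n hn r hr
  have h : DifferentiableAt ℝ (iteratedDeriv n B) r := by
    have h1 : ContDiffWithinAt ℝ N B Set.univ r := hB.contDiffAt (hU.mem_nhds hr)
    rw [← iteratedDerivWithin_univ, ← differentiableWithinAt_univ]
    exact h1.differentiableWithinAt_iteratedDerivWithin (by exact_mod_cast hn)
      (by simp [uniqueDiffOn_univ])
  simpa [iteratedDeriv_succ] using h.hasDerivAt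

theorem isOpen_chart {U : Set ℝ} (hU : IsOpen U) : IsOpen (chart U) :=
  (hU.preimage (continuous_apply 1)).inter (isOpen_Ioo.preimage (continuous_apply 2))

theorem pd_congr {U : Set ℝ} (hU : IsOpen U) {f h : Pt → ℝ}
    (hfh : ∀ y ∈ chart U, f y = h y) {x : Pt} (hx : x ∈ chart U) (i : Fin 4) :
    pd i f x = pd i h x := by
  have hc : Continuous fun s : ℝ => Function.update x i s :=
    continuous_const.update i continuous_id
  have hm : ∀ᶠ s in nhds (x i), Function.update x i s ∈ chart U :=
    hc.continuousAt.eventually_mem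
      ((isOpen_chart hU).mem_nhds (by rwa [Function.update_eq_self]))
  exact Filter.EventuallyEq.deriv_eq (hm.mono fun s hs => hfh _ hs)

/-- No differentiability is needed: in each direction one factor is a constant, and `deriv` commutes
with constant multiples in any case. -/
theorem pd_radial_angular (f w : ℝ → ℝ) (x : Pt) (i : Fin 4) :
    pd i (fun y => f (y 1) * w (y 2)) x =
      ![0, deriv f (x 1) * w (x 2), f (x 1) * deriv w (x 2), 0] i := by
  fin_cases i <;> simp [pd]

theorem pd_const_mul (c : ℝ) (f : Pt → ℝ) (x : Pt) (i : Fin 4) :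
    pd i (fun y => c * f y) x = c * pd i f x := by
  simp [pd]

/-- The partial derivatives of a function that agrees on the chart with a product of a radial
and an angular factor. -/
theorem pd_of_eq_mul {U : Set ℝ} (hU : IsOpen U) {F : Pt → ℝ} {f w : ℝ → ℝ}
    (hF : ∀ y ∈ chart U, F y = f (y 1) * w (y 2)) {x : Pt} (hx : x ∈ chart U) {f' w' : ℝ}
    (hf : HasDerivAt f f' (x 1)) (hw : HasDerivAt w w' (x 2)) (i : Fin 4) :
    pd i F x = ![0, f' * w (x 2), f (x 1) * w', 0] i := by
  rw [pd_congr hU hF hx, pd_radial_angular, hf.deriv, hw.deriv]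

/-! ### The metric, its inverse and the Christoffel symbols -/

/-- The radial factors of the diagonal of the metric. -/
noncomputable def rad (b : ℕ → ℝ → ℝ) (i : Fin 4) (r : ℝ) : ℝ :=
  ![-b 0 r, 1 / b 0 r, r ^ 2, r ^ 2] i

/-- The derivatives of the radial factors `rad`. -/
noncomputable def rad' (b : ℕ → ℝ → ℝ) (i : Fin 4) (r : ℝ) : ℝ :=
  ![-b 1 r, -b 1 r / b 0 r ^ 2, 2 * r, 2 * r] i

/-- The angular factors of the diagonal of the metric. -/
noncomputable def ang (i : Fin 4) (θ : ℝ) : ℝ := ![1, 1, 1, Real.sin θ ^ 2] i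

/-- The derivatives of the angular factors `ang`. -/
noncomputable def ang' (i : Fin 4) (θ : ℝ) : ℝ :=
  ![0, 0, 0, 2 * Real.sin θ * Real.cos θ] i

theorem hasDerivAt_ang (i : Fin 4) (θ : ℝ) : HasDerivAt (ang i) (ang' i θ) θ := by
  have h : HasDerivAt (fun θ => Real.sin θ ^ 2) (2 * Real.sin θ * Real.cos θ) θ := by
    simpa using (Real.hasDerivAt_sin θ).fun_pow 2
  fin_cases i <;> first | exact hasDerivAt_const θ (1 : ℝ) | exact h

theorem hasDerivAt_rad {b : ℕ → ℝ → ℝ} {N : ℕ} {U : Set ℝ} (hb : IsJet b N U) (hN : 0 < N)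
    {r : ℝ} (hr : r ∈ U) (h0 : b 0 r ≠ 0) (i : Fin 4) :
    HasDerivAt (rad b i) (rad' b i r) r := by
  have h2 : HasDerivAt (fun r : ℝ => r ^ 2) (2 * r) r := by simpa using hasDerivAt_pow 2 r
  have hB := hb 0 hN r hr
  fin_cases i
  · exact hB.neg
  · have := hB.inv h0
    simp only [← one_div] at this
    exact this
  · exact h2
  · exact h2

theorem metric_apply (b : ℕ → ℝ → ℝ) (x : Pt) (i j : Fin 4) :
    metric (b 0) x i j = if i = j then rad b i (x 1) * ang i (x 2) else 0 := by
  rw [metric, Matrix.diagonal_apply]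
  fin_cases i <;> simp [rad, ang]

theorem rad_ne_zero {b : ℕ → ℝ → ℝ} {r : ℝ} (hr : r ≠ 0) (h0 : b 0 r ≠ 0) (i : Fin 4) :
    rad b i r ≠ 0 := by
  fin_cases i <;> simp [rad, hr, h0]

theorem ang_ne_zero {θ : ℝ} (hs : Real.sin θ ≠ 0) (i : Fin 4) : ang i θ ≠ 0 := by
  fin_cases i <;> simp [ang, hs]

theorem ginv_metric {b : ℕ → ℝ → ℝ} {x : Pt} (hr : x 1 ≠ 0) (h0 : b 0 (x 1) ≠ 0)
    (hs : Real.sin (x 2) ≠ 0) (i j : Fin 4) :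
    ginv (metric (b 0)) x i j = if i = j then (rad b i (x 1) * ang i (x 2))⁻¹ else 0 := by
  have h : metric (b 0) x = Matrix.diagonal fun i => rad b i (x 1) * ang i (x 2) := by
    ext i j; rw [metric_apply, Matrix.diagonal_apply]
  have h' : (metric (b 0) x)⁻¹ = Matrix.diagonal fun i => (rad b i (x 1) * ang i (x 2))⁻¹ := by
    rw [h]
    apply Matrix.inv_eq_right_inv
    rw [Matrix.diagonal_mul_diagonal, ← Matrix.diagonal_one]
    congr 1
    ext i
    exact mul_inv_cancel₀ (mul_ne_zero (rad_ne_zero hr h0 i) (ang_ne_zero hs i))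
  rw [ginv, h', Matrix.diagonal_apply]

theorem pd_metric {b : ℕ → ℝ → ℝ} {N : ℕ} {U : Set ℝ} (hU : IsOpen U) (hb : IsJet b N U)
    (hN : 0 < N) {x : Pt} (hx : x ∈ chart U) (h0 : b 0 (x 1) ≠ 0) (i j k : Fin 4) :
    pd i (fun y => metric (b 0) y j k) x =
      if j = k then
        ![0, rad' b j (x 1) * ang j (x 2), rad b j (x 1) * ang' j (x 2), 0] i else 0 := by
  split_ifs with h
  · subst h
    exact pd_of_eq_mul hU (fun y _ => by rw [metric_apply, if_pos rfl]) hx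
      (hasDerivAt_rad hb hN hx.1 h0 j) (hasDerivAt_ang j _) i
  · simp [metric_apply, h, pd]

/-- The radial factors of the Christoffel symbols `Γ^p_{jk}`. -/
noncomputable def gamR (b : ℕ → ℝ → ℝ) (p j k : Fin 4) (r : ℝ) : ℝ :=
  ![![![0, b 1 r / (2 * b 0 r), 0, 0], ![b 1 r / (2 * b 0 r), 0, 0, 0], 0, 0],
    ![![b 0 r * b 1 r / 2, 0, 0, 0], ![0, -b 1 r / (2 * b 0 r), 0, 0],
      ![0, 0, -r * b 0 r, 0], ![0, 0, 0, -r * b 0 r]],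
    ![0, ![0, 0, r⁻¹, 0], ![0, r⁻¹, 0, 0], ![0, 0, 0, 1]],
    ![0, ![0, 0, 0, r⁻¹], ![0, 0, 0, 1], ![0, r⁻¹, 1, 0]]] p j k

/-- The derivatives of the radial factors `gamR`. -/
noncomputable def gamR' (b : ℕ → ℝ → ℝ) (p j k : Fin 4) (r : ℝ) : ℝ :=
  ![![![0, (b 2 r * b 0 r - b 1 r ^ 2) / (2 * b 0 r ^ 2), 0, 0],
      ![(b 2 r * b 0 r - b 1 r ^ 2) / (2 * b 0 r ^ 2), 0, 0, 0], 0, 0],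
    ![![(b 0 r * b 2 r + b 1 r ^ 2) / 2, 0, 0, 0],
      ![0, -(b 2 r * b 0 r - b 1 r ^ 2) / (2 * b 0 r ^ 2), 0, 0],
      ![0, 0, -b 0 r - r * b 1 r, 0], ![0, 0, 0, -b 0 r - r * b 1 r]],
    ![0, ![0, 0, -(r ^ 2)⁻¹, 0], ![0, -(r ^ 2)⁻¹, 0, 0], 0],
    ![0, ![0, 0, 0, -(r ^ 2)⁻¹], 0, ![0, -(r ^ 2)⁻¹, 0, 0]]] p j k

/-- The angular factors of the Christoffel symbols `Γ^p_{jk}`. -/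
noncomputable def gamA (p j k : Fin 4) (θ : ℝ) : ℝ :=
  ![1,
    ![1, 1, 1, ![1, 1, 1, Real.sin θ ^ 2]],
    ![1, 1, 1, ![1, 1, 1, -(Real.sin θ * Real.cos θ)]],
    ![1, 1, ![1, 1, 1, Real.cos θ / Real.sin θ], ![1, 1, Real.cos θ / Real.sin θ, 1]]] p j k

/-- The derivatives of the angular factors `gamA`. -/
noncomputable def gamA' (p j k : Fin 4) (θ : ℝ) : ℝ :=
  ![0,
    ![0, 0, 0, ![0, 0, 0, 2 * Real.sin θ * Real.cos θ]],
    ![0, 0, 0, ![0, 0, 0, Real.sin θ ^ 2 - Real.cos θ ^ 2]],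
    ![0, 0, ![0, 0, 0, -(Real.sin θ ^ 2)⁻¹], ![0, 0, -(Real.sin θ ^ 2)⁻¹, 0]]] p j k

theorem hasDerivAt_gamR {b : ℕ → ℝ → ℝ} {N : ℕ} {U : Set ℝ} (hb : IsJet b N U) (hN : 1 < N)
    {r : ℝ} (hr : r ∈ U) (hr0 : r ≠ 0) (h0 : b 0 r ≠ 0) (p j k : Fin 4) :
    HasDerivAt (gamR b p j k) (gamR' b p j k r) r := by
  have hB := hb 0 (by omega) r hr
  have hB' := hb 1 hN r hr
  have e1 : HasDerivAt (fun r => b 1 r / (2 * b 0 r))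
      ((b 2 r * b 0 r - b 1 r ^ 2) / (2 * b 0 r ^ 2)) r := by
    refine (hB'.div (hB.const_mul 2) (by simpa using h0)).congr_deriv ?_
    simp only [zero_add, Nat.reduceAdd]
    field_simp
  have e2 : HasDerivAt (fun r => -b 1 r / (2 * b 0 r))
      (-(b 2 r * b 0 r - b 1 r ^ 2) / (2 * b 0 r ^ 2)) r := by
    simpa only [neg_div] using e1.fun_neg
  have e3 : HasDerivAt (fun r => b 0 r * b 1 r / 2) ((b 0 r * b 2 r + b 1 r ^ 2) / 2) r := by
    refine ((hB.mul hB').div_const 2).congr_deriv ?_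
    simp only [zero_add, Nat.reduceAdd]
    ring
  have e4 : HasDerivAt (fun r => -r * b 0 r) (-b 0 r - r * b 1 r) r := by
    refine ((hasDerivAt_id r).neg.mul hB).congr_deriv ?_
    simp only [zero_add, Pi.neg_apply, id]
    ring
  have e5 : HasDerivAt (fun r : ℝ => r⁻¹) (-(r ^ 2)⁻¹) r := hasDerivAt_inv hr0
  have z : HasDerivAt (fun _ : ℝ => (0 : ℝ)) 0 r := hasDerivAt_const r 0
  have o : HasDerivAt (fun _ : ℝ => (1 : ℝ)) 0 r := hasDerivAt_const r 1
  fin_cases p <;> fin_cases j <;> fin_cases k <;>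
    first | exact z | exact o | exact e1 | exact e2 | exact e3 | exact e4 | exact e5

theorem hasDerivAt_gamA {θ : ℝ} (hs : Real.sin θ ≠ 0) (p j k : Fin 4) :
    HasDerivAt (gamA p j k) (gamA' p j k θ) θ := by
  have e1 : HasDerivAt (fun θ => Real.sin θ ^ 2) (2 * Real.sin θ * Real.cos θ) θ := by
    simpa using (Real.hasDerivAt_sin θ).fun_pow 2
  have e2 : HasDerivAt (fun θ => -(Real.sin θ * Real.cos θ))
      (Real.sin θ ^ 2 - Real.cos θ ^ 2) θ := by
    refine ((Real.hasDerivAt_sin θ).mul (Real.hasDerivAt_cos θ)).neg.congr_deriv ?_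
    ring
  have e3 : HasDerivAt (fun θ => Real.cos θ / Real.sin θ) (-(Real.sin θ ^ 2)⁻¹) θ := by
    refine ((Real.hasDerivAt_cos θ).div (Real.hasDerivAt_sin θ) hs).congr_deriv ?_
    field_simp
    linear_combination -Real.sin_sq_add_cos_sq θ
  have o : HasDerivAt (fun _ : ℝ => (1 : ℝ)) 0 θ := hasDerivAt_const θ 1
  fin_cases p <;> fin_cases j <;> fin_cases k <;>
    first | exact o | exact e1 | exact e2 | exact e3

theorem christoffel_metric {b : ℕ → ℝ → ℝ} {N : ℕ} {U : Set ℝ} (hU : IsOpen U)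
    (hb : IsJet b N U) (hN : 0 < N) {x : Pt} (hx : x ∈ chart U) (hr : x 1 ≠ 0)
    (h0 : b 0 (x 1) ≠ 0) (hs : Real.sin (x 2) ≠ 0) (p j k : Fin 4) :
    christoffel (metric (b 0)) x p j k = gamR b p j k (x 1) * gamA p j k (x 2) := by
  simp only [christoffel, ginv_metric hr h0 hs, pd_metric hU hb hN hx h0, ite_mul, zero_mul,
    Finset.sum_ite_eq, Finset.mem_univ, if_true]
  fin_cases p <;> fin_cases j <;> fin_cases k <;>
    simp [rad, rad', ang, ang', gamR, gamA] <;> field_simp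

/-- Hypotheses on the radial function `b 0` and its derivatives: it is positive and `N` times
differentiable on the open set `U ⊆ (0, ∞)`. -/
structure RadialData (b : ℕ → ℝ → ℝ) (N : ℕ) (U : Set ℝ) : Prop where
  isOpen : IsOpen U
  pos : ∀ r ∈ U, 0 < r
  jet : IsJet b N U
  pos_jet : ∀ r ∈ U, 0 < b 0 r

section

variable {b : ℕ → ℝ → ℝ} {N : ℕ} {U : Set ℝ} {x : Pt}

theorem RadialData.ne (h : RadialData b N U) (hx : x ∈ chart U) : x 1 ≠ 0 :=
  (h.pos _ hx.1).ne'

theorem RadialData.jet_ne (h : RadialData b N U) (hx : x ∈ chart U) : b 0 (x 1) ≠ 0 :=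
  (h.pos_jet _ hx.1).ne'

theorem sin_ne_zero_of_mem_chart (hx : x ∈ chart U) : Real.sin (x 2) ≠ 0 :=
  (Real.sin_pos_of_mem_Ioo hx.2).ne'

theorem RadialData.christoffel_eq (h : RadialData b N U) (hN : 0 < N) (hx : x ∈ chart U)
    (p j k : Fin 4) :
    christoffel (metric (b 0)) x p j k = gamR b p j k (x 1) * gamA p j k (x 2) :=
  christoffel_metric h.isOpen h.jet hN hx (h.ne hx) (h.jet_ne hx)
    (sin_ne_zero_of_mem_chart hx) p j k

theorem RadialData.ginv_eq (h : RadialData b N U) (hx : x ∈ chart U) (i j : Fin 4) :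
    ginv (metric (b 0)) x i j = if i = j then (rad b i (x 1) * ang i (x 2))⁻¹ else 0 :=
  ginv_metric (h.ne hx) (h.jet_ne hx) (sin_ne_zero_of_mem_chart hx) i j

theorem RadialData.pd_christoffel (h : RadialData b N U) (hN : 1 < N) (hx : x ∈ chart U)
    (i p j k : Fin 4) :
    pd i (fun y => christoffel (metric (b 0)) y p j k) x =
      ![0, gamR' b p j k (x 1) * gamA p j k (x 2),
        gamR b p j k (x 1) * gamA' p j k (x 2), 0] i :=
  pd_of_eq_mul h.isOpen (fun _ hy => h.christoffel_eq (by omega) hy p j k) hx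
    (hasDerivAt_gamR h.jet hN hx.1 (h.ne hx) (h.jet_ne hx) p j k)
    (hasDerivAt_gamA (sin_ne_zero_of_mem_chart hx) p j k) i

/-! ### Riemann, Ricci and scalar curvature -/

/-- The sectional curvatures of the coordinate planes. -/
noncomputable def sec (b : ℕ → ℝ → ℝ) (j k : Fin 4) (r : ℝ) : ℝ :=
  ![![0, -b 2 r / 2, -b 1 r / (2 * r), -b 1 r / (2 * r)],
    ![-b 2 r / 2, 0, -b 1 r / (2 * r), -b 1 r / (2 * r)],
    ![-b 1 r / (2 * r), -b 1 r / (2 * r), 0, (1 - b 0 r) / r ^ 2],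
    ![-b 1 r / (2 * r), -b 1 r / (2 * r), (1 - b 0 r) / r ^ 2, 0]] j k

theorem riemann_swap (g : Metric4) (x : Pt) (j k l m : Fin 4) :
    riemann g x j k l m = -riemann g x k j l m := by
  simp only [riemann, ← Finset.sum_neg_distrib, Finset.sum_sub_distrib]
  refine Finset.sum_congr rfl fun p _ => ?_
  ring

theorem RadialData.riemann_eq_of_lt (h : RadialData b N U) (hN : 1 < N) (hx : x ∈ chart U)
    {j k : Fin 4} (hjk : j < k) (l m : Fin 4) :
    riemann (metric (b 0)) x j k l m = sec b j k (x 1) *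
      (metric (b 0) x j l * metric (b 0) x k m - metric (b 0) x j m * metric (b 0) x k l) := by
  have hr := h.ne hx
  have h0 := h.jet_ne hx
  have hs := sin_ne_zero_of_mem_chart hx
  -- Differentiating -sin θ cos θ produces cos² θ; eliminating it leaves identities in independent
  -- symbols.
  have hsc : Real.cos (x 2) ^ 2 = 1 - Real.sin (x 2) ^ 2 := Real.cos_sq' _
  simp only [riemann, h.pd_christoffel hN hx, h.christoffel_eq (by omega) hx, metric_apply,
    ite_mul, zero_mul, Finset.sum_ite_eq, Finset.mem_univ, if_true]
  fin_cases j <;> fin_cases k <;> first | exact absurd hjk (by decide) | skip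
  all_goals fin_cases l <;> fin_cases m <;>
    simp [Fin.sum_univ_four, rad, ang, gamR, gamR', gamA, gamA', sec, -mul_eq_mul_left_iff,
      -mul_eq_mul_right_iff, -mul_eq_zero] <;>
    field_simp <;> (try simp only [hsc]) <;> ring

theorem RadialData.riemann_eq (h : RadialData b N U) (hN : 1 < N) (hx : x ∈ chart U)
    (j k l m : Fin 4) :
    riemann (metric (b 0)) x j k l m = sec b j k (x 1) *
      (metric (b 0) x j l * metric (b 0) x k m - metric (b 0) x j m * metric (b 0) x k l) := by
  -- Antisymmetry in the first pair leaves only the six coordinate planes to compute.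
  rcases lt_trichotomy j k with hjk | rfl | hjk
  · exact h.riemann_eq_of_lt hN hx hjk l m
  · have := riemann_swap (metric (b 0)) x j j l m
    have h0 : sec b j j (x 1) = 0 := by fin_cases j <;> rfl
    rw [h0]
    linarith
  · have h0 : sec b j k (x 1) = sec b k j (x 1) := by fin_cases j <;> fin_cases k <;> rfl
    rw [riemann_swap, h.riemann_eq_of_lt hN hx hjk l m, h0]
    ring

/-- The eigenvalues of the Ricci tensor. -/
noncomputable def ricR (b : ℕ → ℝ → ℝ) (k : Fin 4) (r : ℝ) : ℝ :=
  ![-b 2 r / 2 - b 1 r / r, -b 2 r / 2 - b 1 r / r,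
    (1 - b 0 r) / r ^ 2 - b 1 r / r, (1 - b 0 r) / r ^ 2 - b 1 r / r] k

/-- The derivatives of the eigenvalues of the Ricci tensor. -/
noncomputable def ricR' (b : ℕ → ℝ → ℝ) (k : Fin 4) (r : ℝ) : ℝ :=
  ![-b 3 r / 2 - b 2 r / r + b 1 r / r ^ 2, -b 3 r / 2 - b 2 r / r + b 1 r / r ^ 2,
    -2 * (1 - b 0 r) / r ^ 3 - b 2 r / r, -2 * (1 - b 0 r) / r ^ 3 - b 2 r / r] k

/-- The curvature scalar as a function of the radius. -/
noncomputable def scalR (b : ℕ → ℝ → ℝ) (r : ℝ) : ℝ :=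
  2 * (1 - b 0 r) / r ^ 2 - 4 * b 1 r / r - b 2 r

theorem hasDerivAt_ricR (h : RadialData b N U) (hN : 2 < N) {r : ℝ} (hr : r ∈ U) (k : Fin 4) :
    HasDerivAt (ricR b k) (ricR' b k r) r := by
  have hr0 : r ≠ 0 := (h.pos r hr).ne'
  have h0 := h.jet 0 (by omega) r hr
  have h1 := h.jet 1 (by omega) r hr
  have h2 := h.jet 2 hN r hr
  have e1 : HasDerivAt (fun r => -b 2 r / 2 - b 1 r / r)
      (-b 3 r / 2 - b 2 r / r + b 1 r / r ^ 2) r := by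
    refine ((h2.fun_neg.div_const 2).fun_sub (h1.fun_div (hasDerivAt_id' r) hr0)).congr_deriv ?_
    simp only [Nat.reduceAdd]
    field_simp
    ring
  have e2 : HasDerivAt (fun r => (1 - b 0 r) / r ^ 2 - b 1 r / r)
      (-2 * (1 - b 0 r) / r ^ 3 - b 2 r / r) r := by
    refine (((h0.const_sub 1).fun_div (hasDerivAt_pow 2 r) (pow_ne_zero 2 hr0)).fun_sub
      (h1.fun_div (hasDerivAt_id' r) hr0)).congr_deriv ?_
    simp only [Nat.reduceAdd, zero_add]
    field_simp
    ring
  fin_cases k <;> first | exact e1 | exact e2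

theorem hasDerivAt_scalR (h : RadialData b N U) (hN : 2 < N) {r : ℝ} (hr : r ∈ U) :
    HasDerivAt (scalR b) (-4 * (1 - b 0 r) / r ^ 3 + 2 * b 1 r / r ^ 2 - 4 * b 2 r / r - b 3 r)
      r := by
  have hr0 : r ≠ 0 := (h.pos r hr).ne'
  have h0 := h.jet 0 (by omega) r hr
  have h1 := h.jet 1 (by omega) r hr
  have h2 := h.jet 2 hN r hr
  refine (((((h0.const_sub 1).const_mul 2).fun_div (hasDerivAt_pow 2 r)
    (pow_ne_zero 2 hr0)).fun_sub
      ((h1.const_mul 4).fun_div (hasDerivAt_id' r) hr0)).fun_sub h2).congr_deriv ?_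
  simp only [Nat.reduceAdd, zero_add]
  field_simp
  ring

theorem sum_diagonal (f : Fin 4 → ℝ) (F : Fin 4 → Fin 4 → ℝ) :
    ∑ i, ∑ j, (if i = j then f i else 0) * F i j = ∑ i, f i * F i i := by
  simp

theorem RadialData.ricci_eq (h : RadialData b N U) (hN : 1 < N) (hx : x ∈ chart U)
    (k m : Fin 4) :
    ricci (metric (b 0)) x k m = ricR b k (x 1) * metric (b 0) x k m := by
  have hr := h.ne hx
  have h0 := h.jet_ne hx
  have hs := sin_ne_zero_of_mem_chart hx
  simp only [ricci, h.ginv_eq hx, h.riemann_eq hN hx, sum_diagonal, metric_apply]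
  fin_cases k <;> fin_cases m <;>
    simp [Fin.sum_univ_four, rad, ang, sec, ricR] <;> field_simp <;> ring

theorem RadialData.scalarCurv_eq (h : RadialData b N U) (hN : 1 < N) (hx : x ∈ chart U) :
    scalarCurv (metric (b 0)) x = scalR b (x 1) := by
  have hr := h.ne hx
  have h0 := h.jet_ne hx
  have hs := sin_ne_zero_of_mem_chart hx
  simp only [scalarCurv, h.ginv_eq hx, h.ricci_eq hN hx, sum_diagonal, metric_apply]
  simp [Fin.sum_univ_four, rad, ang, scalR, ricR]
  field_simp
  ring

/-! ### The Weyl tensor -/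

/-- The weights of the coordinate planes in the Weyl tensor. -/
noncomputable def weylSign (j k : Fin 4) : ℝ :=
  ![![0, 2, -1, -1], ![2, 0, -1, -1], ![-1, -1, 0, 2], ![-1, -1, 2, 0]] j k

/-- The eigenvalue of the Weyl tensor on the planes orthogonal to `u` and to the radial
direction, up to the sign `weylSign`. -/
noncomputable def weylR (b : ℕ → ℝ → ℝ) (r : ℝ) : ℝ :=
  ((1 - b 0 r) / r ^ 2 + b 1 r / r - b 2 r / 2) / 6

/-- The derivative of `weylR`. -/
noncomputable def weylR' (b : ℕ → ℝ → ℝ) (r : ℝ) : ℝ :=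
  (-2 * (1 - b 0 r) / r ^ 3 - 2 * b 1 r / r ^ 2 + b 2 r / r - b 3 r / 2) / 6

theorem hasDerivAt_weylR (h : RadialData b N U) (hN : 2 < N) {r : ℝ} (hr : r ∈ U) :
    HasDerivAt (weylR b) (weylR' b r) r := by
  have hr0 : r ≠ 0 := (h.pos r hr).ne'
  have h0 := h.jet 0 (by omega) r hr
  have h1 := h.jet 1 (by omega) r hr
  have h2 := h.jet 2 hN r hr
  refine (((((h0.const_sub 1).fun_div (hasDerivAt_pow 2 r) (pow_ne_zero 2 hr0)).fun_add
    (h1.fun_div (hasDerivAt_id' r) hr0)).fun_sub (h2.div_const 2)).div_const 6).congr_deriv ?_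
  simp only [Nat.reduceAdd, zero_add, weylR']
  field_simp
  ring

theorem RadialData.weyl_eq (h : RadialData b N U) (hN : 1 < N) (hx : x ∈ chart U)
    (j k l m : Fin 4) :
    weyl (metric (b 0)) x j k l m = weylSign j k * weylR b (x 1) *
      (metric (b 0) x j l * metric (b 0) x k m - metric (b 0) x j m * metric (b 0) x k l) := by
  have hr := h.ne hx
  -- A diagonal Ricci tensor turns each correction term into a multiple of the bracket g_{jl} g_{km}
  -- - g_{jm} g_{kl}. The scalar identity is needed only off the diagonal, because the bracket
  -- vanishes when j = k.
  have key : j = k ∨ sec b j k (x 1) - (ricR b j (x 1) + ricR b k (x 1)) / 2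
      + scalR b (x 1) / 6 = weylSign j k * weylR b (x 1) := by
    fin_cases j <;> fin_cases k <;> simp [sec, ricR, scalR, weylSign, weylR] <;>
      field_simp <;> ring
  simp only [weyl, h.riemann_eq hN hx, h.ricci_eq hN hx, h.scalarCurv_eq hN hx]
  rcases key with rfl | key
  · ring
  · rw [← key]
    ring

theorem RadialData.hasDerivAt_rad (h : RadialData b N U) (hN : 0 < N) {r : ℝ} (hr : r ∈ U)
    (i : Fin 4) : HasDerivAt (rad b i) (rad' b i r) r :=
  StaticSpherical.hasDerivAt_rad h.jet hN hr (h.pos_jet r hr).ne' i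

theorem RadialData.pd_ricci (h : RadialData b N U) (hN : 2 < N) (hx : x ∈ chart U)
    (i k m : Fin 4) :
    pd i (fun y => ricci (metric (b 0)) y k m) x =
      if k = m then
        ![0, (ricR' b k (x 1) * rad b k (x 1) + ricR b k (x 1) * rad' b k (x 1)) * ang k (x 2),
          ricR b k (x 1) * rad b k (x 1) * ang' k (x 2), 0] i else 0 := by
  split_ifs with hkm
  · subst hkm
    refine pd_of_eq_mul h.isOpen (f := fun r => ricR b k r * rad b k r) (fun y hy => ?_) hx
      ((hasDerivAt_ricR h hN hx.1 k).fun_mul (h.hasDerivAt_rad (by omega) hx.1 k))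
      (hasDerivAt_ang k _) i
    rw [h.ricci_eq (by omega) hy, metric_apply, if_pos rfl, mul_assoc]
  · rw [pd_congr h.isOpen (h := fun _ => 0) (fun y hy => ?_) hx]
    · simp [pd]
    · rw [h.ricci_eq (by omega) hy, metric_apply, if_neg hkm, mul_zero]

theorem RadialData.pd_scalarCurv (h : RadialData b N U) (hN : 2 < N) (hx : x ∈ chart U)
    (i : Fin 4) :
    pd i (scalarCurv (metric (b 0))) x =
      ![0, -4 * (1 - b 0 (x 1)) / x 1 ^ 3 + 2 * b 1 (x 1) / x 1 ^ 2 - 4 * b 2 (x 1) / x 1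
        - b 3 (x 1), 0, 0] i := by
  rw [pd_of_eq_mul h.isOpen (f := scalR b) (w := fun _ => 1) (fun y hy => ?_) hx
      (hasDerivAt_scalR h hN hx.1) (hasDerivAt_const _ _) i]
  · fin_cases i <;> simp
  · rw [h.scalarCurv_eq (by omega) hy, mul_one]

/-! ### The Cotton tensor -/

/-- The radial function that generates the Cotton tensor. -/
noncomputable def cotP (b : ℕ → ℝ → ℝ) (r : ℝ) : ℝ :=
  2 * (1 - b 0 r) / (3 * r ^ 3) + 2 * b 1 r / (3 * r ^ 2) - b 2 r / (3 * r) - b 3 r / 3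

/-- The derivative of `cotP`. -/
noncomputable def cotP' (b : ℕ → ℝ → ℝ) (r : ℝ) : ℝ :=
  -2 * (1 - b 0 r) / r ^ 4 - 2 * b 1 r / r ^ 3 + b 2 r / r ^ 2 - b 3 r / (3 * r) - b 4 r / 3

/-- The weights of the coordinate directions in the Cotton tensor. -/
noncomputable def cotSign (k : Fin 4) : ℝ := ![1, 0, -1 / 2, -1 / 2] k

theorem hasDerivAt_cotP (h : RadialData b N U) (hN : 3 < N) {r : ℝ} (hr : r ∈ U) :
    HasDerivAt (cotP b) (cotP' b r) r := by
  have hr0 : r ≠ 0 := (h.pos r hr).ne'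
  have h0 := h.jet 0 (by omega) r hr
  have h1 := h.jet 1 (by omega) r hr
  have h2 := h.jet 2 (by omega) r hr
  have h3 := h.jet 3 hN r hr
  refine ((((((h0.const_sub 1).const_mul 2).fun_div ((hasDerivAt_pow 3 r).const_mul 3)
    (mul_ne_zero three_ne_zero (pow_ne_zero 3 hr0))).fun_add
      ((h1.const_mul 2).fun_div ((hasDerivAt_pow 2 r).const_mul 3)
        (mul_ne_zero three_ne_zero (pow_ne_zero 2 hr0)))).fun_sub
      (h2.fun_div ((hasDerivAt_id' r).const_mul 3)
        (mul_ne_zero three_ne_zero hr0))).fun_sub (h3.div_const 3)).congr_deriv ?_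
  simp only [Nat.reduceAdd, zero_add, cotP']
  field_simp
  ring

/-- Only C_{1kl} = -C_{k1l} survives, and it is diagonal in k, l. The weights 1, -1/2, -1/2 sum to
zero, so it is trace-free; the weight at k = 1 cancels by antisymmetry. -/
theorem RadialData.cotton_eq (h : RadialData b N U) (hN : 2 < N) (hx : x ∈ chart U)
    (j k l : Fin 4) :
    cotton (metric (b 0)) x j k l =
      ((if j = 1 ∧ k = l then cotSign k else 0) - (if k = 1 ∧ j = l then cotSign j else 0)) *
        (cotP b (x 1) * rad b l (x 1)) * ang l (x 2) := by
  have hr := h.ne hx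
  have h0 := h.jet_ne hx
  have hs := sin_ne_zero_of_mem_chart hx
  simp only [cotton, cov2, h.pd_ricci hN hx, h.pd_scalarCurv hN hx,
    h.christoffel_eq (by omega) hx, h.ricci_eq (by omega) hx, metric_apply, mul_ite, mul_zero,
    Finset.sum_ite_eq, Finset.sum_ite_eq', Finset.mem_univ, if_true]
  fin_cases j <;> fin_cases k <;> fin_cases l <;>
    simp [rad, ang, rad', ang', gamR, gamA, ricR, ricR', cotSign, cotP,
      -mul_eq_mul_left_iff, -mul_eq_mul_right_iff, -mul_eq_zero] <;>
    field_simp <;> ring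

/-! ### Divergence of the Weyl tensor -/

theorem RadialData.pd_weyl (h : RadialData b N U) (hN : 2 < N) (hx : x ∈ chart U)
    (i j k l m : Fin 4) :
    pd i (fun y => weyl (metric (b 0)) y j k l m) x =
      (weylSign j k * ((if j = l ∧ k = m then 1 else 0) - (if j = m ∧ k = l then 1 else 0))) *
      ![0, (weylR' b (x 1) * (rad b j (x 1) * rad b k (x 1)) + weylR b (x 1) *
          (rad' b j (x 1) * rad b k (x 1) + rad b j (x 1) * rad' b k (x 1))) *
            (ang j (x 2) * ang k (x 2)),
        weylR b (x 1) * (rad b j (x 1) * rad b k (x 1)) *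
          (ang' j (x 2) * ang k (x 2) + ang j (x 2) * ang' k (x 2)), 0] i := by
  -- The bracket is nonzero only when (l, m) is (j, k) or (k, j), and its value is then ±g_{jj}
  -- g_{kk}; this separates the radial and angular factors.
  have key : ∀ y ∈ chart U, weyl (metric (b 0)) y j k l m =
      (weylSign j k * ((if j = l ∧ k = m then 1 else 0) - (if j = m ∧ k = l then 1 else 0))) *
      (weylR b (y 1) * (rad b j (y 1) * rad b k (y 1)) * (ang j (y 2) * ang k (y 2))) := by
    intro y hy
    rw [h.weyl_eq (by omega) hy]
    simp only [metric_apply]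
    by_cases h1 : j = l <;> by_cases h2 : k = m <;> by_cases h3 : j = m <;>
      by_cases h4 : k = l <;> simp [h1, h2, h3, h4] <;> (try subst_vars) <;>
      (try simp_all) <;> ring
  rw [pd_congr h.isOpen key hx, pd_const_mul]
  congr 1
  exact pd_of_eq_mul h.isOpen
    (f := fun r => weylR b r * (rad b j r * rad b k r)) (w := fun θ => ang j θ * ang k θ)
    (fun y _ => rfl) hx
    ((hasDerivAt_weylR h hN hx.1).fun_mul
      ((h.hasDerivAt_rad (by omega) hx.1 j).fun_mul (h.hasDerivAt_rad (by omega) hx.1 k)))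
    ((hasDerivAt_ang j _).fun_mul (hasDerivAt_ang k _)) i

-- This is the contracted second Bianchi identity, whose factor (n - 3)/(n - 2) is 1/2 in dimension
-- four; here it is checked on components.
set_option maxHeartbeats 1000000 in
theorem RadialData.divWeyl_eq (h : RadialData b N U) (hN : 2 < N) (hx : x ∈ chart U)
    (j k l : Fin 4) :
    divWeyl (metric (b 0)) x j k l = -(1 / 2) * cotton (metric (b 0)) x j k l := by
  have hr := h.ne hx
  have h0 := h.jet_ne hx
  have hs := sin_ne_zero_of_mem_chart hx
  simp only [divWeyl, h.ginv_eq hx, sum_diagonal, cov4, h.pd_weyl hN hx,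
    h.christoffel_eq (by omega) hx, h.weyl_eq (by omega) hx, h.cotton_eq hN hx, metric_apply]
  fin_cases j <;> fin_cases k <;> fin_cases l <;>
    simp [Fin.sum_univ_four, rad, ang, rad', ang', gamR, gamA, weylSign,
      cotSign, -mul_eq_mul_left_iff, -mul_eq_mul_right_iff, -mul_eq_zero] <;>
    (try simp only [weylR, weylR', cotP]) <;> field_simp <;> ring

theorem RadialData.pd_cotton (h : RadialData b N U) (hN : 3 < N) (hx : x ∈ chart U)
    (i j k l : Fin 4) :
    pd i (fun y => cotton (metric (b 0)) y j k l) x =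
      ((if j = 1 ∧ k = l then cotSign k else 0) - (if k = 1 ∧ j = l then cotSign j else 0)) *
      ![0, (cotP' b (x 1) * rad b l (x 1) + cotP b (x 1) * rad' b l (x 1)) * ang l (x 2),
        cotP b (x 1) * rad b l (x 1) * ang' l (x 2), 0] i := by
  rw [pd_congr h.isOpen (fun y hy => (h.cotton_eq (by omega) hy j k l).trans
    (mul_assoc _ _ _)) hx, pd_const_mul]
  congr 1
  exact pd_of_eq_mul h.isOpen (f := fun r => cotP b r * rad b l r) (w := ang l)
    (fun y _ => rfl) hx
    ((hasDerivAt_cotP h hN hx.1).fun_mul (h.hasDerivAt_rad (by omega) hx.1 l))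
    (hasDerivAt_ang l _) i

/-! ### The Bach tensor and its divergence -/

/-- The part of the eigenvalues of the Bach tensor that is common to all directions up to sign. -/
noncomputable def bachT (b : ℕ → ℝ → ℝ) (r : ℝ) : ℝ :=
  (1 - b 0 r ^ 2) / (3 * r ^ 4) + 2 * (b 0 r * b 1 r) / (3 * r ^ 3)
    - (b 1 r ^ 2 + b 0 r * b 2 r) / (3 * r ^ 2) + b 1 r * b 2 r / (3 * r)
    - b 2 r ^ 2 / 12 + b 1 r * b 3 r / 6

/-- The eigenvalues of the Bach tensor. -/
noncomputable def bachR (b : ℕ → ℝ → ℝ) (k : Fin 4) (r : ℝ) : ℝ :=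
  ![bachT b r + b 0 r * b 3 r / r + b 0 r * b 4 r / 3, bachT b r - b 0 r * b 3 r / (3 * r),
    -bachT b r - b 0 r * b 3 r / (3 * r) - b 0 r * b 4 r / 6,
    -bachT b r - b 0 r * b 3 r / (3 * r) - b 0 r * b 4 r / 6] k

/-- The derivative of the radial eigenvalue of the Bach tensor. -/
noncomputable def bachR' (b : ℕ → ℝ → ℝ) (r : ℝ) : ℝ :=
  -4 * (1 - b 0 r ^ 2) / (3 * r ^ 5) - 8 * (b 0 r * b 1 r) / (3 * r ^ 4)
    + 4 * (b 1 r ^ 2 + b 0 r * b 2 r) / (3 * r ^ 3)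
    - (4 * (b 1 r * b 2 r) + b 0 r * b 3 r) / (3 * r ^ 2) + b 2 r ^ 2 / (3 * r)
    + b 1 r * b 4 r / 6 - b 0 r * b 4 r / (3 * r) + b 0 r * b 3 r / (3 * r ^ 2)

theorem RadialData.bach_eq_cotton (h : RadialData b N U) (hN : 2 < N) (hx : x ∈ chart U)
    (k l : Fin 4) :
    bach (metric (b 0)) x k l =
      -div3 (metric (b 0)) (cotton (metric (b 0))) x k l + ricciWeyl (metric (b 0)) x k l := by
  have key : div3 (metric (b 0)) (divWeyl (metric (b 0))) x k l =
      -(1 / 2) * div3 (metric (b 0)) (cotton (metric (b 0))) x k l := by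
    have hp : ∀ i j k l, pd i (fun y => divWeyl (metric (b 0)) y j k l) x =
        -(1 / 2) * pd i (fun y => cotton (metric (b 0)) y j k l) x := fun i j k l => by
      rw [pd_congr h.isOpen (fun y hy => h.divWeyl_eq hN hy j k l) hx, pd_const_mul]
    simp only [div3, cov3, hp, h.divWeyl_eq hN hx, Finset.mul_sum]
    refine Finset.sum_congr rfl fun i _ => Finset.sum_congr rfl fun j _ => ?_
    simp only [mul_sub, Finset.mul_sum, mul_left_comm (-(1 / 2 : ℝ))]
  rw [bach, key]
  ring

theorem RadialData.bach_eq (h : RadialData b N U) (hN : 3 < N) (hx : x ∈ chart U)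
    (k l : Fin 4) :
    bach (metric (b 0)) x k l = bachR b k (x 1) * metric (b 0) x k l := by
  have hr := h.ne hx
  have h0 := h.jet_ne hx
  have hs := sin_ne_zero_of_mem_chart hx
  have hw : ricciWeyl (metric (b 0)) x k l =
      ∑ j, ricR b j (x 1) * weylSign j k * weylR b (x 1) * (rad b j (x 1) * ang j (x 2))⁻¹ *
        (metric (b 0) x j l * metric (b 0) x k j
          - metric (b 0) x j j * metric (b 0) x k l) := by
    -- Ricci with both indices raised is diagonal, so the contraction with Weyl is a single sum.
    have hR : ∀ j m, ∑ a, ∑ c, ginv (metric (b 0)) x j a * ginv (metric (b 0)) x m c *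
        ricci (metric (b 0)) x a c =
        if j = m then ricR b j (x 1) * (rad b j (x 1) * ang j (x 2))⁻¹ else 0 := by
      intro j m
      simp only [h.ginv_eq hx, h.ricci_eq (by omega) hx, metric_apply, ite_mul, zero_mul,
        mul_ite, mul_zero, Finset.sum_ite_eq, Finset.mem_univ, if_true]
      by_cases hjm : j = m
      · subst hjm
        simp only [if_true]
        have h1 := mul_ne_zero (rad_ne_zero hr h0 j) (ang_ne_zero hs j)
        field_simp
      · simp [hjm]
    simp only [ricciWeyl, hR, sum_diagonal, h.weyl_eq (by omega) hx]
    refine Finset.sum_congr rfl fun j _ => ?_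
    ring
  rw [h.bach_eq_cotton (by omega) hx, hw]
  simp only [div3, cov3, h.ginv_eq hx, sum_diagonal, h.pd_cotton hN hx,
    h.christoffel_eq (by omega) hx, h.cotton_eq (by omega) hx, metric_apply]
  fin_cases k <;> fin_cases l <;>
    simp [Fin.sum_univ_four, rad, ang, rad', ang', gamR, gamA, weylSign, ricR, cotSign, bachR,
      -mul_eq_mul_left_iff, -mul_eq_mul_right_iff, -mul_eq_zero] <;>
    (try simp only [weylR, cotP, cotP', bachT]) <;> field_simp <;> ring

/-- The radial eigenvalue is the only one without `b 4`, so a fourth derivative of `b 0` is enough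
to differentiate it. -/
theorem hasDerivAt_bachR (h : RadialData b N U) (hN : 3 < N) {r : ℝ} (hr : r ∈ U) :
    HasDerivAt (bachR b 1) (bachR' b r) r := by
  have hr0 : r ≠ 0 := (h.pos r hr).ne'
  have h0 := h.jet 0 (by omega) r hr
  have h1 := h.jet 1 (by omega) r hr
  have h2 := h.jet 2 (by omega) r hr
  have h3 := h.jet 3 hN r hr
  have hp : ∀ n : ℕ, HasDerivAt (fun r : ℝ => 3 * r ^ n) (3 * (n * r ^ (n - 1))) r :=
    fun n => (hasDerivAt_pow n r).const_mul 3
  have hp1 : HasDerivAt (fun r : ℝ => 3 * r) (3 * 1) r := (hasDerivAt_id' r).const_mul 3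
  have hn : ∀ n : ℕ, 3 * r ^ n ≠ 0 := fun n => mul_ne_zero three_ne_zero (pow_ne_zero n hr0)
  have hn1 : 3 * r ≠ 0 := mul_ne_zero three_ne_zero hr0
  refine HasDerivAt.congr_deriv (f := fun r => bachT b r - b 0 r * b 3 r / (3 * r))
    (HasDerivAt.fun_sub ((((((((h0.fun_pow 2).const_sub 1).fun_div (hp 4) (hn 4)).fun_add
      (((h0.fun_mul h1).const_mul 2).fun_div (hp 3) (hn 3))).fun_sub
      (((h1.fun_pow 2).fun_add (h0.fun_mul h2)).fun_div (hp 2) (hn 2))).fun_add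
      ((h1.fun_mul h2).fun_div hp1 hn1)).fun_sub ((h2.fun_pow 2).div_const 12)).fun_add
      ((h1.fun_mul h3).div_const 6))
      ((h0.fun_mul h3).fun_div hp1 hn1)) ?_
  simp only [Nat.reduceAdd, zero_add, bachR']
  field_simp
  push_cast
  ring

/-- The l = 1 component is λ₁' + (B'/2B)(λ₁ - λ₀) + (2/r)(λ₁ - λ₂) = 0. In the l = 2 component the
cot θ terms cancel because the two angular eigenvalues agree. -/
theorem RadialData.div2_bach (h : RadialData b N U) (hN : 3 < N) (hx : x ∈ chart U)
    (l : Fin 4) : div2 (metric (b 0)) (bach (metric (b 0))) x l = 0 := by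
  have hr := h.ne hx
  have h0 := h.jet_ne hx
  have hs := sin_ne_zero_of_mem_chart hx
  have hp : ∀ k, pd k (fun y => bach (metric (b 0)) y k l) x =
      if k = l then
        ![0, bachR' b (x 1) * rad b 1 (x 1) + bachR b 1 (x 1) * rad' b 1 (x 1), 0, 0] k
      else 0 := by
    intro k
    split_ifs with hkl
    · subst hkl
      -- `pd_of_eq_mul` would require every eigenvalue to be differentiable, hence a fifth
      -- derivative. The divergence differentiates the kk entry only along k, so the r-derivative is
      -- taken for k = 1 alone.
      rw [pd_congr h.isOpen (h := fun y => (bachR b k (y 1) * rad b k (y 1)) * ang k (y 2))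
        (fun y hy => by rw [h.bach_eq hN hy, metric_apply, if_pos rfl, mul_assoc]) hx,
        pd_radial_angular (fun r => bachR b k r * rad b k r) (ang k) x k,
        (hasDerivAt_ang k (x 2)).deriv]
      have hd := ((hasDerivAt_bachR h hN hx.1).fun_mul
        (h.hasDerivAt_rad (by omega) hx.1 1)).deriv
      fin_cases k
      · rfl
      · simp [hd, ang]
      · simp [ang']
      · rfl
    · rw [pd_congr h.isOpen (h := fun _ => 0) (fun y hy => ?_) hx]
      · simp [pd]
      · rw [h.bach_eq hN hy, metric_apply, if_neg hkl, mul_zero]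
  simp only [div2, cov2, h.ginv_eq hx, sum_diagonal, hp, h.christoffel_eq (by omega) hx,
    h.bach_eq hN hx, metric_apply]
  fin_cases l <;>
    simp [Fin.sum_univ_four, rad, ang, rad', gamR, gamA, bachR,
      -mul_eq_mul_left_iff, -mul_eq_mul_right_iff, -mul_eq_zero] <;>
    (try simp only [bachT, bachR']) <;> field_simp <;> ring

/-! ### From jets back to B: the coefficients A, E and A' + A/r -/

theorem exists_radialData (hU : IsOpen U) (hU0 : ∀ r ∈ U, 0 < r) {B : ℝ → ℝ}
    (hB : ContDiffOn ℝ N B U) (hB0 : ∀ r ∈ U, 0 < B r) :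
    ∃ b : ℕ → ℝ → ℝ, RadialData b N U ∧ b 0 = B :=
  ⟨fun n => iteratedDeriv n B,
    ⟨hU, hU0, isJet_iteratedDeriv hU hB, by simpa [iteratedDeriv_zero] using hB0⟩,
    iteratedDeriv_zero⟩

theorem RadialData.deriv_eq (h : RadialData b N U) {n : ℕ} (hn : n < N) {r : ℝ} (hr : r ∈ U) :
    deriv (b n) r = b (n + 1) r :=
  (h.jet n hn r hr).deriv

theorem RadialData.deriv_deriv_eq (h : RadialData b N U) (hN : 1 < N) {r : ℝ} (hr : r ∈ U) :
    deriv (deriv (b 0)) r = b 2 r := by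
  have he : deriv (b 0) =ᶠ[nhds r] b 1 :=
    Filter.eventually_of_mem (h.isOpen.mem_nhds hr) fun s hs => h.deriv_eq (by omega) hs
  rw [he.deriv_eq, h.deriv_eq hN hr]

theorem RadialData.coeffA_eq (h : RadialData b N U) (hN : 1 < N) {r : ℝ} (hr : r ∈ U) :
    coeffA (b 0) r = (1 - b 0 r) / r ^ 2 + b 2 r / 2 := by
  rw [coeffA, h.deriv_deriv_eq hN hr]

theorem RadialData.coeffE_eq (h : RadialData b N U) (hN : 1 < N) {r : ℝ} (hr : r ∈ U) :
    coeffE (b 0) r = (1 / 2) * ((1 - b 0 r) / r ^ 2 + b 1 r / r - b 2 r / 2) := by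
  rw [coeffE, h.deriv_deriv_eq hN hr, h.deriv_eq (by omega) hr]

theorem RadialData.coeffQ_eq (h : RadialData b N U) (hN : 2 < N) {r : ℝ} (hr : r ∈ U) :
    coeffQ (b 0) r = -(1 - b 0 r) / r ^ 3 - b 1 r / r ^ 2 + b 2 r / (2 * r) + b 3 r / 2 := by
  have hr0 : r ≠ 0 := (h.pos r hr).ne'
  have h0 := h.jet 0 (by omega) r hr
  have h2 := h.jet 2 hN r hr
  have he : coeffA (b 0) =ᶠ[nhds r] fun r => (1 - b 0 r) / r ^ 2 + b 2 r / 2 :=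
    Filter.eventually_of_mem (h.isOpen.mem_nhds hr) fun s hs => h.coeffA_eq (by omega) hs
  rw [coeffQ, he.deriv_eq, (((h0.const_sub 1).fun_div (hasDerivAt_pow 2 r)
    (pow_ne_zero 2 hr0)).fun_add (h2.div_const 2)).deriv, h.coeffA_eq (by omega) hr]
  simp only [Nat.reduceAdd, zero_add]
  field_simp
  ring

theorem RadialData.deriv_coeffQ_eq (h : RadialData b N U) (hN : 3 < N) {r : ℝ} (hr : r ∈ U) :
    deriv (coeffQ (b 0)) r = 3 * (1 - b 0 r) / r ^ 4 + 3 * b 1 r / r ^ 3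
      - 3 * b 2 r / (2 * r ^ 2) + b 3 r / (2 * r) + b 4 r / 2 := by
  have hr0 : r ≠ 0 := (h.pos r hr).ne'
  have h0 := h.jet 0 (by omega) r hr
  have h1 := h.jet 1 (by omega) r hr
  have h2 := h.jet 2 (by omega) r hr
  have h3 := h.jet 3 hN r hr
  have he : coeffQ (b 0) =ᶠ[nhds r] fun r =>
      -(1 - b 0 r) / r ^ 3 - b 1 r / r ^ 2 + b 2 r / (2 * r) + b 3 r / 2 :=
    Filter.eventually_of_mem (h.isOpen.mem_nhds hr) fun s hs => h.coeffQ_eq (by omega) hs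
  rw [he.deriv_eq, ((((((h0.const_sub 1).fun_neg.fun_div (hasDerivAt_pow 3 r)
    (pow_ne_zero 3 hr0)).fun_sub (h1.fun_div (hasDerivAt_pow 2 r) (pow_ne_zero 2 hr0))).fun_add
    (h2.fun_div ((hasDerivAt_id' r).const_mul 2) (mul_ne_zero two_ne_zero hr0))).fun_add
    (h3.div_const 2))).deriv]
  simp only [Nat.reduceAdd, zero_add]
  field_simp
  push_cast
  ring

/-! ### Velocity and acceleration -/

theorem RadialData.acceleration_eq (h : RadialData b N U) (hN : 0 < N) (hx : x ∈ chart U)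
    (k : Fin 4) :
    acceleration (b 0) x k = if k = 1 then b 1 (x 1) / (2 * b 0 (x 1)) else 0 := by
  have h0 := h.jet_ne hx
  have hq : Real.sqrt (b 0 (x 1)) * Real.sqrt (b 0 (x 1)) = b 0 (x 1) :=
    Real.mul_self_sqrt (h.pos_jet _ hx.1).le
  have hv : ∀ j : Fin 4, velocity (b 0) x j = if j = 0 then -Real.sqrt (b 0 (x 1)) else 0 := by
    intro j
    fin_cases j <;> simp [velocity]
  -- The velocity points along t, so only ∇_t enters; the partial derivative vanishes by staticity
  -- and u̇_k comes from Γ^t_{tk} alone.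
  have hp : pd 0 (fun y => velocity (b 0) y k) x = 0 := by
    simp [pd, velocity]
  simp only [acceleration, h.ginv_eq hx, hv, mul_ite, mul_zero, Finset.sum_ite_eq',
    Finset.mem_univ, if_true, ite_mul, zero_mul, cov1, hp, h.christoffel_eq hN hx]
  fin_cases k <;> simp [rad, ang, gamR, gamA]
  field_simp
  linear_combination b 1 (x 1) * hq

theorem RadialData.eta_eq (h : RadialData b N U) (hN : 0 < N) (hx : x ∈ chart U) :
    eta (b 0) x = b 1 (x 1) ^ 2 / (4 * b 0 (x 1)) := by
  have h0 := h.jet_ne hx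
  simp only [eta, h.ginv_eq hx, h.acceleration_eq hN hx]
  simp [rad, ang]
  field_simp
  ring

/-! ### Symmetry, trace and the decomposition along u and u̇ -/

theorem RadialData.bach_symm (h : RadialData b N U) (hN : 3 < N) (hx : x ∈ chart U)
    (k l : Fin 4) : bach (metric (b 0)) x k l = bach (metric (b 0)) x l k := by
  rw [h.bach_eq hN hx, h.bach_eq hN hx, metric_apply, metric_apply]
  by_cases hkl : k = l
  · subst hkl
    rfl
  · rw [if_neg hkl, if_neg (Ne.symm hkl), mul_zero, mul_zero]

theorem bachR_zero_eq (b : ℕ → ℝ → ℝ) (r : ℝ) :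
    bachR b 0 r = -bachR b 1 r - 2 * bachR b 2 r := by
  simp [bachR]
  ring

theorem RadialData.trace_bach (h : RadialData b N U) (hN : 3 < N) (hx : x ∈ chart U) :
    ∑ k, ∑ l, ginv (metric (b 0)) x k l * bach (metric (b 0)) x k l = 0 := by
  have hk : ∀ k, (rad b k (x 1) * ang k (x 2))⁻¹ *
      (bachR b k (x 1) * (rad b k (x 1) * ang k (x 2))) = bachR b k (x 1) := fun k => by
    rw [mul_left_comm, inv_mul_cancel₀ (mul_ne_zero (rad_ne_zero (h.ne hx) (h.jet_ne hx) k)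
      (ang_ne_zero (sin_ne_zero_of_mem_chart hx) k)), mul_one]
  have h3 : bachR b 3 (x 1) = bachR b 2 (x 1) := rfl
  simp only [h.bach_eq hN hx, h.ginv_eq hx, sum_diagonal, metric_apply, if_true, hk]
  rw [Fin.sum_univ_four, bachR_zero_eq, h3]
  ring

/-- The two sides are B₁ + B₂ for B₁ = λ₂ - λ₀, B₂ = λ₁ - λ₂; the common part `bachT` cancels, which
is why no quadratic curvature term appears, unlike in `RadialData.bachR_sub_eq`. -/
theorem RadialData.bachR_add_eq (h : RadialData b N U) (hN : 3 < N) {r : ℝ} (hr : r ∈ U) :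
    bachR b 2 r - bachR b 0 r + (bachR b 1 r - bachR b 2 r) =
      -(2 * b 0 r / r) * coeffQ (b 0) r - 2 * b 0 r / 3 * deriv (coeffQ (b 0)) r := by
  have hr0 : r ≠ 0 := (h.pos r hr).ne'
  rw [h.coeffQ_eq (by omega) hr, h.deriv_coeffQ_eq hN hr]
  simp [bachR]
  field_simp
  ring

theorem RadialData.bachR_sub_eq (h : RadialData b N U) (hN : 3 < N) {r : ℝ} (hr : r ∈ U) :
    bachR b 2 r - bachR b 0 r - (bachR b 1 r - bachR b 2 r) =
      -(8 / 3) * coeffA (b 0) r * coeffE (b 0) r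
        - 4 / 3 * coeffQ (b 0) r * (deriv (b 0) r + b 0 r / r)
        - 4 * b 0 r / 3 * deriv (coeffQ (b 0)) r := by
  have hr0 : r ≠ 0 := (h.pos r hr).ne'
  rw [h.coeffQ_eq (by omega) hr, h.deriv_coeffQ_eq hN hr, h.coeffA_eq (by omega) hr,
    h.coeffE_eq (by omega) hr, h.deriv_eq (by omega) hr]
  simp [bachR, bachT]
  field_simp
  ring

theorem RadialData.eta_pos (h : RadialData b N U) (hN : 0 < N) (hx : x ∈ chart U)
    (h1 : b 1 (x 1) ≠ 0) : 0 < eta (b 0) x := by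
  have hp := h.pos_jet _ hx.1
  rw [h.eta_eq hN hx]
  positivity

theorem RadialData.bach_eq_velocity_acceleration (h : RadialData b N U) (hN : 3 < N)
    (hx : x ∈ chart U) (h1 : b 1 (x 1) ≠ 0) (k l : Fin 4) :
    bach (metric (b 0)) x k l =
      (bachR b 2 (x 1) - bachR b 0 (x 1)) * velocity (b 0) x k * velocity (b 0) x l
      + 1 / 4 * (bachR b 2 (x 1) - bachR b 0 (x 1) - (bachR b 1 (x 1) - bachR b 2 (x 1))) *
        metric (b 0) x k l
      + (bachR b 1 (x 1) - bachR b 2 (x 1)) *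
        (acceleration (b 0) x k * acceleration (b 0) x l / eta (b 0) x) := by
  have h0 := h.jet_ne hx
  have hq : Real.sqrt (b 0 (x 1)) ^ 2 = b 0 (x 1) := Real.sq_sqrt (h.pos_jet _ hx.1).le
  have h3 : bachR b 3 (x 1) = bachR b 2 (x 1) := rfl
  rw [h.eta_eq (by omega) hx, h.bach_eq hN hx, h.acceleration_eq (by omega) hx,
    h.acceleration_eq (by omega) hx]
  simp only [metric_apply]
  fin_cases k <;> fin_cases l <;>
    simp [velocity, rad, ang, h3, bachR_zero_eq,
      -mul_eq_mul_left_iff, -mul_eq_mul_right_iff, -mul_eq_zero] <;>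
    field_simp <;> (try simp only [hq]) <;> ring

end

end StaticSpherical

theorem mainTheorem6 (U : Set ℝ) (hU : IsOpen U) (hU0 : ∀ r ∈ U, 0 < r)
    (B : ℝ → ℝ) (hB : ContDiffOn ℝ 4 B U) (hB0 : ∀ r ∈ U, 0 < B r) :
    -- the two expressions of the Bach tensor agree; it is symmetric and traceless
    (∀ x : StaticSpherical.Pt, x 1 ∈ U → x 2 ∈ Set.Ioo 0 Real.pi →
      (∀ k l : Fin 4,
        StaticSpherical.bach (StaticSpherical.metric B) x k l =
          -StaticSpherical.div3 (StaticSpherical.metric B)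
              (StaticSpherical.cotton (StaticSpherical.metric B)) x k l
            + StaticSpherical.ricciWeyl (StaticSpherical.metric B) x k l) ∧
      (∀ k l : Fin 4,
        StaticSpherical.bach (StaticSpherical.metric B) x k l =
          StaticSpherical.bach (StaticSpherical.metric B) x l k) ∧
      ∑ k, ∑ l, StaticSpherical.ginv (StaticSpherical.metric B) x k l *
        StaticSpherical.bach (StaticSpherical.metric B) x k l = 0) ∧
    -- it is divergence-free, as soon as its components are differentiable
    (ContDiffOn ℝ 5 B U →
      ∀ x : StaticSpherical.Pt, x 1 ∈ U → x 2 ∈ Set.Ioo 0 Real.pi → ∀ l : Fin 4,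
        StaticSpherical.div2 (StaticSpherical.metric B)
          (StaticSpherical.bach (StaticSpherical.metric B)) x l = 0) ∧
    -- its expression through the velocity, the metric and the acceleration
    ∃ B₁ B₂ : ℝ → ℝ,
      (∀ r ∈ U, B₁ r + B₂ r =
        -(2 * B r / r) * StaticSpherical.coeffQ B r
          - 2 * B r / 3 * deriv (StaticSpherical.coeffQ B) r) ∧
      (∀ r ∈ U, B₁ r - B₂ r =
        -(8 / 3) * StaticSpherical.coeffA B r * StaticSpherical.coeffE B r
          - 4 / 3 * StaticSpherical.coeffQ B r * (deriv B r + B r / r)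
          - 4 * B r / 3 * deriv (StaticSpherical.coeffQ B) r) ∧
      ∀ x : StaticSpherical.Pt, x 1 ∈ U → x 2 ∈ Set.Ioo 0 Real.pi → deriv B (x 1) ≠ 0 →
        0 < StaticSpherical.eta B x ∧
        ∀ k l : Fin 4,
          StaticSpherical.bach (StaticSpherical.metric B) x k l =
            B₁ (x 1) * StaticSpherical.velocity B x k * StaticSpherical.velocity B x l
            + 1 / 4 * (B₁ (x 1) - B₂ (x 1)) * StaticSpherical.metric B x k l
            + B₂ (x 1) * (StaticSpherical.acceleration B x k *
                StaticSpherical.acceleration B x l / StaticSpherical.eta B x) := by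
  obtain ⟨b, h, rfl⟩ :=
    StaticSpherical.exists_radialData (N := 4) hU hU0 (by exact_mod_cast hB) hB0
  exact ⟨fun x hx hθ => ⟨h.bach_eq_cotton (by norm_num) ⟨hx, hθ⟩,
      h.bach_symm (by norm_num) ⟨hx, hθ⟩, h.trace_bach (by norm_num) ⟨hx, hθ⟩⟩,
    fun _ x hx hθ => h.div2_bach (by norm_num) ⟨hx, hθ⟩,
    -- These choices are forced at points with B' ≠ 0: the angular entries fix the metric
    -- coefficient λ₂, and the tt and rr entries then give B₁ and B₂.
    fun r => StaticSpherical.bachR b 2 r - StaticSpherical.bachR b 0 r,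
    fun r => StaticSpherical.bachR b 1 r - StaticSpherical.bachR b 2 r,
    fun r hr => h.bachR_add_eq (by norm_num) hr, fun r hr => h.bachR_sub_eq (by norm_num) hr,
    fun x hx hθ hB' => by
      have h1 : b 1 (x 1) ≠ 0 := by rwa [h.deriv_eq (by norm_num) hx] at hB'
      exact ⟨h.eta_pos (by norm_num) ⟨hx, hθ⟩ h1,
        h.bach_eq_velocity_acceleration (by norm_num) ⟨hx, hθ⟩ h1⟩⟩
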